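/- Let $n\ge 1$ and let ${\bf a}=(a_1,\dots,a_n)$ be a vector of nonnegative integers with $a_1>0$. The Tesler polytope $\mathsf{Tes}_n({\bf a})$ is the set of all $n\times n$ upper triangular matrices $(x_{i,j})$ with nonnegative real entries such that $$x_{k,k}+\sum_{j=k+1}^n x_{k,j}-\sum_{i=1}^{k-1}x_{i,k}=a_k\qquad\text{for } k=1,\dots,n.$$ The signature $\epsilon({\bf a})\in\{0,+\}^n$ is the word whose $i$-th letter is $+$ if $a_i>0$ and $0$ if $a_i=0$. A polytope $P$ is called simple if each of its vertices is incident to exactly $\dim(P)$ edges. Then $\mathsf{Tes}_n({\bf a})$ is simple if and only if $n\le 3$ or $\epsilon({\bf a})$ is one of the four words $$+^n,\qquad +^{n-1}0,\qquad +0+^{n-2},\qquad +0+^{n-3}0,$$ where $+^m$ denotes the letter $+$ repeated $m$ times. -/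

import Mathlib

/-! ## Faces, vertices, edges, dimension and simplicity of polytopes -/

section Polytope

variable {E : Type*} [AddCommGroup E] [Module ℝ E]

/-- The dimension of a convex set: the dimension of (the direction of) its affine span. -/
noncomputable def polyDim (P : Set E) : ℕ :=
  Module.finrank ℝ (vectorSpan ℝ P)

variable [TopologicalSpace E]

/-- A (nonempty) face of `P`: the nonempty set of all points of `P` at which some linear functional
attains its maximum over `P`. -/
def IsPolyFace (P F : Set E) : Prop :=
  F.Nonempty ∧ IsExposed ℝ P F

/-- A vertex of `P`: a point `v` such that `{v}` is a face. -/
def IsPolyVertex (P : Set E) (v : E) : Prop :=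
  IsPolyFace P {v}

/-- An edge of `P`: a face of dimension one. -/
def IsPolyEdge (P F : Set E) : Prop :=
  IsPolyFace P F ∧ polyDim F = 1

/-- A polytope `P` is simple if each of its vertices is incident to exactly `dim P` edges. -/
def IsSimplePolytope (P : Set E) : Prop :=
  ∀ v : E, IsPolyVertex P v → {F : Set E | IsPolyEdge P F ∧ v ∈ F}.encard = (polyDim P : ℕ∞)

end Polytope

/-! ## Tesler polytopes -/

/-- The `k`-th hook sum of a matrix: the sum of the entries of row `k` on and to the right of the
diagonal, minus the sum of the entries of column `k` strictly above the diagonal. -/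
noncomputable def hookSum {n : ℕ} (x : Matrix (Fin n) (Fin n) ℝ) (k : Fin n) : ℝ :=
  x k k + ∑ j ∈ Finset.Ioi k, x k j - ∑ i ∈ Finset.Iio k, x i k

/-- The Tesler polytope: upper triangular `n × n` matrices with nonnegative real entries whose
`k`-th hook sum is `a k` for every `k`. -/
def teslerPolytope {n : ℕ} (a : Fin n → ℕ) : Set (Matrix (Fin n) (Fin n) ℝ) :=
  {x | (∀ i j, j < i → x i j = 0) ∧ (∀ i j, 0 ≤ x i j) ∧ ∀ k, hookSum x k = (a k : ℝ)}

/-- The letters of a signature. -/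
inductive SigLetter : Type
  | zero : SigLetter
  | plus : SigLetter

/-- The signature of a vector of nonnegative integers, as a word of length `n` in the letters
`0` and `+`; for instance, the signature of `(7, 0, 3, 0)` is `+0+0`. -/
def signature {n : ℕ} (a : Fin n → ℕ) : List SigLetter :=
  List.ofFn fun i => if a i = 0 then SigLetter.zero else SigLetter.plus

/-! Near a vertex `v` the polytope looks like `v` plus a cone with finitely many extreme rays, one
for each edge. The rays span the direction space, so `v` has the right number of edges exactly when
they are linearly independent (`encard_edges_eq_polyDim_iff`).

Read `x i j` with `i < j` as flow from `i` to `j`, `x i i` as flow leaving the network at `i`, and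
`a k` as flow injected at `k`. At a vertex each row has at most one nonzero entry, say in column `f
i`, and the entries off the graph of `f` are free coordinates on the direction space. If no row but
possibly the last vanishes, the cone is an orthant in these coordinates and `v` is a simple vertex.

If `k` is the only vanishing row besides possibly the last, then both column `k` above the diagonal
and row `k` must stay nonnegative, with equal sums. This gives a cone over a product of simplices
with `k` and `n - k` vertices (`k` counted from 0), whose rays are the transits `i → k → j`. For two
choices of `i` and of `j` they satisfy `(i, j) + (i', j') = (i, j') + (i', j)`. Since `n - k ≥ 2`,
independence means `k = 1` (`encard_edges_of_transit_iff`).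

A zero row `k` forces `a k = 0`. Conversely, if `a k = 0` at an interior `k`, routing all flow
around `k` gives a vertex whose only zero row is `k` (`exists_vertex_avoiding`). So simplicity means
that a zero of `a` before the last position can only be at index 1, which the list of words encodes.
-/

/-! ### Edges at a vertex with a finitely generated cone -/

section EdgesAtVertex

variable {E : Type*} [AddCommGroup E] [Module ℝ E] [TopologicalSpace E]
  {ι : Type*} [Fintype ι] {P : Set E} {v : E} {u : ι → E}

/-- If `P` is locally generated at `v` by the vectors `u i`, then the face of `P` cut out by a
functional that attains its maximum at `v` consists of the points of `P` that differ from `v` by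
a combination of the `u i` on which the functional vanishes. -/
theorem exposed_eq_of_generated (hv : v ∈ P)
    (hgen : ∀ x ∈ P, ∃ c : ι → ℝ, (∀ i, 0 ≤ c i) ∧ x = v + ∑ i, c i • u i)
    (l : StrongDual ℝ E) (hl : ∀ i, l (u i) ≤ 0) :
    {x ∈ P | ∀ y ∈ P, l y ≤ l x} =
      {x ∈ P | x - v ∈ Submodule.span ℝ (u '' {i | l (u i) = 0})} := by
  have hmax : ∀ y ∈ P, l y ≤ l v := by
    intro y hy
    obtain ⟨c, hc, rfl⟩ := hgen y hy
    have : ∑ i, c i * l (u i) ≤ 0 :=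
      Finset.sum_nonpos fun i _ => mul_nonpos_of_nonneg_of_nonpos (hc i) (hl i)
    simpa using this
  ext x
  simp only [Set.mem_ofPred_eq]
  refine and_congr_right fun hx => ⟨fun h => ?_, fun h y hy => ?_⟩
  · obtain ⟨c, hc, rfl⟩ := hgen x hx
    have h1 : 0 ≤ ∑ i, c i * l (u i) := by simpa using h v hv
    have h2 : ∀ i ∈ Finset.univ, c i * l (u i) ≤ 0 :=
      fun i _ => mul_nonpos_of_nonneg_of_nonpos (hc i) (hl i)
    have h3 := (Finset.sum_eq_zero_iff_of_nonpos h2).1 (le_antisymm (Finset.sum_nonpos h2) h1)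
    rw [add_sub_cancel_left]
    refine Submodule.sum_mem _ fun i _ => ?_
    rcases mul_eq_zero.1 (h3 i (Finset.mem_univ i)) with h0 | h0
    · simp [h0]
    · exact Submodule.smul_mem _ _ (Submodule.subset_span ⟨i, h0, rfl⟩)
  · have hker : Submodule.span ℝ (u '' {i | l (u i) = 0}) ≤ LinearMap.ker l.toLinearMap := by
      rw [Submodule.span_le]
      rintro _ ⟨i, hi, rfl⟩
      exact hi
    have h0 : l (x - v) = 0 := hker h
    rw [map_sub, sub_eq_zero] at h0
    rw [h0]
    exact hmax y hy

/-- A small multiple of each `u i` is realised inside `P`, so cutting `P` by a span of rays loses no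
dimension. -/
theorem vectorSpan_generated {E ι : Type*} [AddCommGroup E] [Module ℝ E] {P : Set E} {v : E}
    {u : ι → E} (hv : v ∈ P) (hε : ∀ i, ∃ ε : ℝ, 0 < ε ∧ v + ε • u i ∈ P) (s : Set ι) :
    vectorSpan ℝ {x ∈ P | x - v ∈ Submodule.span ℝ (u '' s)} = Submodule.span ℝ (u '' s) := by
  have hmem : v ∈ {x ∈ P | x - v ∈ Submodule.span ℝ (u '' s)} := by simp [hv]
  rw [vectorSpan_eq_span_vsub_set_right ℝ hmem]
  apply le_antisymm
  · rw [Submodule.span_le]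
    rintro _ ⟨x, hx, rfl⟩
    exact hx.2
  · rw [Submodule.span_le]
    rintro _ ⟨i, hi, rfl⟩
    obtain ⟨ε, hε0, hP⟩ := hε i
    have h1 : ε • u i ∈ Submodule.span ℝ ((fun x => x -ᵥ v) ''
        {x ∈ P | x - v ∈ Submodule.span ℝ (u '' s)}) := by
      refine Submodule.subset_span ⟨v + ε • u i, ⟨hP, ?_⟩, by simp⟩
      rw [add_sub_cancel_left]
      exact Submodule.smul_mem _ _ (Submodule.subset_span ⟨i, hi, rfl⟩)
    simpa [smul_smul, hε0.ne'] using Submodule.smul_mem _ ε⁻¹ h1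

theorem polyDim_generated (hv : v ∈ P)
    (hgen : ∀ x ∈ P, ∃ c : ι → ℝ, (∀ i, 0 ≤ c i) ∧ x = v + ∑ i, c i • u i)
    (hε : ∀ i, ∃ ε : ℝ, 0 < ε ∧ v + ε • u i ∈ P) :
    polyDim P = Module.finrank ℝ (Submodule.span ℝ (Set.range u)) := by
  -- The zero functional exposes all of `P`, and every ray lies in its kernel.
  have h := exposed_eq_of_generated hv hgen 0 (by simp)
  have h2 := vectorSpan_generated hv hε (Set.univ)
  simp only [zero_apply, le_refl, implies_true, and_true, Set.ofPred_mem_eq,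
    Set.ofPred_true, Set.image_univ] at h h2
  rw [← h] at h2
  rw [polyDim, h2]

/-- If `P` is locally generated at `v` by finitely many vectors, each of which spans an extreme
ray, then the edges at `v` correspond to these vectors. -/
theorem encard_edges_generated (hv : v ∈ P)
    (hgen : ∀ x ∈ P, ∃ c : ι → ℝ, (∀ i, 0 ≤ c i) ∧ x = v + ∑ i, c i • u i)
    (hε : ∀ i, ∃ ε : ℝ, 0 < ε ∧ v + ε • u i ∈ P) (hne : ∀ i, u i ≠ 0)
    (hl : ∀ i, ∃ l : StrongDual ℝ E, l (u i) = 0 ∧ ∀ j, j ≠ i → l (u j) < 0) :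
    {F : Set E | IsPolyEdge P F ∧ v ∈ F}.encard = Fintype.card ι := by
  choose l hl0 hlneg using hl
  have hlle : ∀ i j, l i (u j) ≤ 0 := fun i j => by
    by_cases h : j = i
    · rw [h, hl0]
    · exact (hlneg i j h).le
  have hset : ∀ i, {j | l i (u j) = 0} = {i} := fun i => by
    ext j
    refine ⟨fun h => ?_, fun h => ?_⟩
    · by_contra hji
      exact (hlneg i j hji).ne h
    · rw [Set.mem_singleton_iff.1 h]; exact hl0 i
  let G : ι → Set E := fun i => {x ∈ P | x - v ∈ Submodule.span ℝ (u '' {i})}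
  have hGv : ∀ i, v ∈ G i := fun i => by simp [G, hv]
  have hGdir : ∀ i, vectorSpan ℝ (G i) = Submodule.span ℝ {u i} := fun i => by
    rw [vectorSpan_generated hv hε, Set.image_singleton]
  have hGinj : Function.Injective G := by
    intro i j hij
    by_contra hne'
    have h1 : Submodule.span ℝ {u i} = Submodule.span ℝ {u j} := by
      rw [← hGdir, hij, hGdir]
    have h2 : u j ∈ Submodule.span ℝ {u i} := h1 ▸ Submodule.mem_span_singleton_self _
    obtain ⟨c, hc⟩ := Submodule.mem_span_singleton.1 h2
    have h3 := hlneg i j (Ne.symm hne')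
    rw [← hc, map_smul, hl0, smul_zero] at h3
    exact lt_irrefl _ h3
  have hrange : {F : Set E | IsPolyEdge P F ∧ v ∈ F} = Set.range G := by
    ext F
    constructor
    · rintro ⟨⟨⟨hFne, hF⟩, hdim⟩, hvF⟩
      obtain ⟨m, hm⟩ := hF hFne
      have hmle : ∀ i, m (u i) ≤ 0 := fun i => by
        obtain ⟨ε, hε0, hP⟩ := hε i
        have h1 := (hm ▸ hvF : v ∈ {x ∈ P | ∀ y ∈ P, m y ≤ m x}).2 _ hP
        rw [map_add, map_smul, smul_eq_mul] at h1
        nlinarith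
      rw [exposed_eq_of_generated hv hgen m hmle] at hm
      rw [polyDim, hm, vectorSpan_generated hv hε] at hdim
      -- The edge spans the rays killed by `m`. Dimension one excludes none, and it excludes two
      -- because `l i` shows that no other ray is proportional to `u i`.
      have hnonempty : {i | m (u i) = 0}.Nonempty := by
        by_contra h
        rw [Set.not_nonempty_iff_eq_empty.1 h, Set.image_empty, Submodule.span_empty,
          finrank_bot] at hdim
        exact zero_ne_one hdim
      obtain ⟨i, hi⟩ := hnonempty
      refine ⟨i, ?_⟩
      have hI : {i | m (u i) = 0} = {i} := by
        refine Set.eq_singleton_iff_unique_mem.2 ⟨hi, fun j hj => ?_⟩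
        by_contra hji
        have hui : u i ∈ Submodule.span ℝ (u '' {i | m (u i) = 0}) :=
          Submodule.subset_span ⟨i, hi, rfl⟩
        have huj : u j ∈ Submodule.span ℝ (u '' {i | m (u i) = 0}) :=
          Submodule.subset_span ⟨j, hj, rfl⟩
        obtain ⟨c, hc⟩ := (finrank_eq_one_iff_of_nonzero' (⟨u i, hui⟩ : Submodule.span ℝ _)
          (fun h => hne i (congrArg Subtype.val h))).1 hdim ⟨u j, huj⟩
        have hc' : c • u i = u j := congrArg Subtype.val hc
        have h3 := hlneg i j hji
        rw [← hc', map_smul, hl0, smul_zero] at h3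
        exact lt_irrefl _ h3
      rw [hm, hI]
    · rintro ⟨i, rfl⟩
      refine ⟨⟨⟨⟨v, hGv i⟩, fun _ => ⟨l i, ?_⟩⟩, ?_⟩, hGv i⟩
      · rw [exposed_eq_of_generated hv hgen (l i) (hlle i), hset]
      · rw [polyDim, hGdir, finrank_span_singleton (hne i)]
  rw [hrange, ← Set.image_univ, hGinj.encard_image, Set.encard_univ, ENat.card_eq_coe_fintype_card]

/-- A vertex with known extreme rays has the right number of edges exactly when the rays are
linearly independent. -/
theorem encard_edges_eq_polyDim_iff (hv : v ∈ P)
    (hgen : ∀ x ∈ P, ∃ c : ι → ℝ, (∀ i, 0 ≤ c i) ∧ x = v + ∑ i, c i • u i)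
    (hε : ∀ i, ∃ ε : ℝ, 0 < ε ∧ v + ε • u i ∈ P) (hne : ∀ i, u i ≠ 0)
    (hl : ∀ i, ∃ l : StrongDual ℝ E, l (u i) = 0 ∧ ∀ j, j ≠ i → l (u j) < 0) :
    {F : Set E | IsPolyEdge P F ∧ v ∈ F}.encard = (polyDim P : ℕ∞) ↔ LinearIndependent ℝ u := by
  rw [encard_edges_generated hv hgen hε hne hl, polyDim_generated hv hgen hε,
    linearIndependent_iff_card_eq_finrank_span, Nat.cast_inj]
  rfl

end EdgesAtVertex

/-! ### Directions of the polytope and their free coordinates -/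

section TeslerDirection

variable {n : ℕ}

/-- The hook sums of a matrix, as a linear map. -/
noncomputable def hookMap (n : ℕ) : Matrix (Fin n) (Fin n) ℝ →ₗ[ℝ] (Fin n → ℝ) where
  toFun x k := hookSum x k
  map_add' x y := by
    ext k
    simp only [hookSum, Matrix.add_apply, Finset.sum_add_distrib, Pi.add_apply]
    ring
  map_smul' c x := by
    ext k
    simp only [hookSum, Matrix.smul_apply, smul_eq_mul, ← Finset.mul_sum, Pi.smul_apply,
      RingHom.id_apply]
    ring

/-- The upper triangular matrices with vanishing hook sums. -/
noncomputable def teslerDirection (n : ℕ) : Submodule ℝ (Matrix (Fin n) (Fin n) ℝ) where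
  carrier := {x | (∀ i j, j < i → x i j = 0) ∧ hookMap n x = 0}
  add_mem' {x y} hx hy := ⟨fun i j h => by simp [hx.1 i j h, hy.1 i j h], by
    rw [map_add, hx.2, hy.2, add_zero]⟩
  zero_mem' := ⟨by simp, map_zero _⟩
  smul_mem' c x hx := ⟨fun i j h => by simp [hx.1 i j h], by rw [map_smul, hx.2, smul_zero]⟩

theorem mem_teslerDirection {x : Matrix (Fin n) (Fin n) ℝ} :
    x ∈ teslerDirection n ↔ (∀ i j, j < i → x i j = 0) ∧ ∀ k, hookSum x k = 0 :=
  and_congr_right fun _ => funext_iff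

theorem sub_mem_teslerDirection {a : Fin n → ℕ} {x y : Matrix (Fin n) (Fin n) ℝ}
    (hx : x ∈ teslerPolytope a) (hy : y ∈ teslerPolytope a) : x - y ∈ teslerDirection n := by
  refine ⟨fun i j h => by simp [hx.1 i j h, hy.1 i j h], ?_⟩
  rw [map_sub, sub_eq_zero]
  ext k
  exact (hx.2.2 k).trans (hy.2.2 k).symm

theorem add_mem_teslerPolytope {a : Fin n → ℕ} {v y : Matrix (Fin n) (Fin n) ℝ}
    (hv : v ∈ teslerPolytope a) (hy : y ∈ teslerDirection n) (h : ∀ i j, 0 ≤ v i j + y i j) :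
    v + y ∈ teslerPolytope a := by
  refine ⟨fun i j hij => by simp [hv.1 i j hij, hy.1 i j hij], h, fun k => ?_⟩
  have h1 : hookMap n (v + y) = hookMap n v := by rw [map_add, hy.2, add_zero]
  exact (congrFun h1 k).trans (hv.2.2 k)

theorem hookSum_eq_row_sub_col {x : Matrix (Fin n) (Fin n) ℝ} (hx : ∀ i j, j < i → x i j = 0)
    (k : Fin n) : hookSum x k = ∑ j, x k j - ∑ i ∈ Finset.Iio k, x i k := by
  have h : ∑ j, x k j = x k k + ∑ j ∈ Finset.Ioi k, x k j := by
    rw [Finset.add_sum_Ioi_eq_sum_Ici]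
    symm
    refine Finset.sum_subset (Finset.subset_univ _) fun j _ hj => hx k j ?_
    simpa using hj
  rw [hookSum, h]

theorem row_eq_col {x : Matrix (Fin n) (Fin n) ℝ} (hx : x ∈ teslerDirection n) (k : Fin n) :
    ∑ j, x k j = ∑ i ∈ Finset.Iio k, x i k := by
  have h := (mem_teslerDirection.1 hx).2 k
  rw [hookSum_eq_row_sub_col hx.1] at h
  linarith

theorem row_eq_add_col {a : Fin n → ℕ} {x : Matrix (Fin n) (Fin n) ℝ} (hx : x ∈ teslerPolytope a)
    (k : Fin n) : ∑ j, x k j = a k + ∑ i ∈ Finset.Iio k, x i k := by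
  have h := hx.2.2 k
  rw [hookSum_eq_row_sub_col hx.1] at h
  linarith

/-- Nothing leaves `k`, so nothing may enter it, either by injection or from earlier rows. -/
theorem col_eq_zero_of_row_eq_zero {a : Fin n → ℕ} {x : Matrix (Fin n) (Fin n) ℝ}
    (hx : x ∈ teslerPolytope a) {k : Fin n} (h : ∀ j, x k j = 0) :
    a k = 0 ∧ ∀ i < k, x i k = 0 := by
  have h1 := row_eq_add_col hx k
  rw [Finset.sum_eq_zero fun j _ => h j] at h1
  have h2 : 0 ≤ ∑ i ∈ Finset.Iio k, x i k := Finset.sum_nonneg fun i _ => hx.2.1 i k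
  have h3 : (0 : ℝ) ≤ a k := Nat.cast_nonneg _
  have h4 : (a k : ℝ) = 0 := by linarith
  have h5 := (Finset.sum_eq_zero_iff_of_nonneg fun i _ => hx.2.1 i k).1
    (show ∑ i ∈ Finset.Iio k, x i k = 0 by linarith)
  exact ⟨Nat.cast_eq_zero.1 h4, fun i hi => h5 i (Finset.mem_Iio.2 hi)⟩

/-- An upper triangular matrix with vanishing hook sums is zero if all but one prescribed entry
of each row vanish. -/
theorem eq_zero_of_mem_teslerDirection {f : Fin n → Fin n} {y : Matrix (Fin n) (Fin n) ℝ}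
    (hy : y ∈ teslerDirection n) (h : ∀ i j, i ≤ j → j ≠ f i → y i j = 0) : y = 0 := by
  have key : ∀ i j, y i j = 0 := by
    intro i
    induction i using WellFoundedLT.induction with
    | ind i ih =>
      have hoff : ∀ j, j ≠ f i → y i j = 0 := fun j hj => by
        rcases lt_or_ge j i with hji | hij
        · exact hy.1 i j hji
        · exact h i j hij hj
      intro j
      by_cases hj : j = f i
      · have h1 := row_eq_col hy i
        rw [Finset.sum_eq_single (f i) (fun j _ hj => hoff j hj) (by simp),
          Finset.sum_eq_zero fun m hm => ih m (Finset.mem_Iio.1 hm) i] at h1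
        rw [hj, h1]
      · exact hoff j hj
  ext i j
  exact key i j

/-- Upper triangular matrices can be prescribed by their hook sums and all but one entry of each
row. -/
theorem exists_hookSum_eq {f : Fin n → Fin n} (hf : ∀ i, i ≤ f i) (z : Matrix (Fin n) (Fin n) ℝ)
    (b : Fin n → ℝ) : ∃ y : Matrix (Fin n) (Fin n) ℝ, (∀ i j, j < i → y i j = 0) ∧
      (∀ k, hookSum y k = b k) ∧ ∀ i j, i ≤ j → j ≠ f i → y i j = z i j := by
  -- `L` overwrites the entry at `(i, f i)` by the `i`-th hook sum. As an injective endomorphism of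
  -- a finite-dimensional space it is surjective.
  let L : Matrix (Fin n) (Fin n) ℝ →ₗ[ℝ] Matrix (Fin n) (Fin n) ℝ :=
    { toFun := fun y => Matrix.of fun i j => if j = f i then hookMap n y i else y i j
      map_add' := fun x y => by
        ext i j
        by_cases h : j = f i <;> simp [h]
      map_smul' := fun c x => by
        ext i j
        by_cases h : j = f i <;> simp [h] }
  have hL : ∀ y i j, L y i j = if j = f i then hookSum y i else y i j := fun y i j => rfl
  have hinj : Function.Injective L := by
    rw [← LinearMap.ker_eq_bot, LinearMap.ker_eq_bot']
    intro y hy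
    have hy' : ∀ i j, (if j = f i then hookSum y i else y i j) = 0 := fun i j => by
      rw [← hL, hy]; rfl
    refine eq_zero_of_mem_teslerDirection (f := f) (mem_teslerDirection.2 ⟨fun i j hij => ?_,
      fun k => ?_⟩) fun i j _ hj => ?_
    · simpa [(hij.trans_le (hf i)).ne] using hy' i j
    · simpa using hy' k (f k)
    · simpa [hj] using hy' i j
  obtain ⟨y, hy⟩ := LinearMap.injective_iff_surjective.1 hinj
    (Matrix.of fun i j => if j = f i then b i else if j < i then 0 else z i j)
  have hy' : ∀ i j, (if j = f i then hookSum y i else y i j) =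
      if j = f i then b i else if j < i then 0 else z i j := fun i j => by
    rw [← hL, hy]; rfl
  refine ⟨y, fun i j hij => ?_, fun k => ?_, fun i j hij hj => ?_⟩
  · simpa [(hij.trans_le (hf i)).ne, hij] using hy' i j
  · simpa using hy' k (f k)
  · simpa [hj, hij.not_gt] using hy' i j

theorem exists_mem_teslerDirection {f : Fin n → Fin n} (hf : ∀ i, i ≤ f i)
    (z : Matrix (Fin n) (Fin n) ℝ) :
    ∃ y ∈ teslerDirection n, ∀ i j, i ≤ j → j ≠ f i → y i j = z i j := by
  obtain ⟨y, h1, h2, h3⟩ := exists_hookSum_eq hf z 0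
  exact ⟨y, mem_teslerDirection.2 ⟨h1, h2⟩, h3⟩

theorem exists_pos_add_smul_nonneg {v y : Matrix (Fin n) (Fin n) ℝ} (hv : ∀ i j, 0 ≤ v i j)
    (hy : ∀ i j, v i j = 0 → 0 ≤ y i j) :
    ∃ ε : ℝ, 0 < ε ∧ ∀ i j, 0 ≤ v i j + (ε • y) i j := by
  have h : ∀ᶠ ε : ℝ in nhdsWithin 0 (Set.Ioi 0), ∀ i j, 0 ≤ v i j + ε * y i j := by
    refine Filter.eventually_all.2 fun i => Filter.eventually_all.2 fun j => ?_
    rcases (hv i j).eq_or_lt with h0 | h0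
    · filter_upwards [self_mem_nhdsWithin] with ε hε
      rw [← h0, zero_add]
      exact mul_nonneg (le_of_lt hε) (hy i j h0.symm)
    · have hc : Continuous fun ε : ℝ => v i j + ε * y i j := by fun_prop
      have := (hc.tendsto 0).eventually (lt_mem_nhds (a := (0 : ℝ)) (by simpa using h0))
      exact (this.filter_mono nhdsWithin_le_nhds).mono fun _ h => le_of_lt h
  obtain ⟨ε, h1, h2⟩ := (h.and self_mem_nhdsWithin).exists
  exact ⟨ε, h2, h1⟩

/-- Minus the sum of the entries of a matrix at a set of positions. -/
noncomputable def negEntrySum (s : Finset (Fin n × Fin n)) :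
    StrongDual ℝ (Matrix (Fin n) (Fin n) ℝ) :=
  LinearMap.toContinuousLinearMap (-∑ p ∈ s, Matrix.entryLinearMap ℝ ℝ p.1 p.2)

theorem negEntrySum_apply (s : Finset (Fin n × Fin n)) (x : Matrix (Fin n) (Fin n) ℝ) :
    negEntrySum s x = -∑ p ∈ s, x p.1 p.2 := by
  simp [negEntrySum]

end TeslerDirection

/-! ### Vertices as matrices with at most one nonzero entry per row -/

section TeslerVertices

variable {n : ℕ} {a : Fin n → ℕ} {v : Matrix (Fin n) (Fin n) ℝ}

/-- Minus the sum of the entries that vanish at `v` is maximal exactly at points sharing those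
zeros, and the conservation equations leave only `v`. -/
theorem isPolyVertex_of_row_support {f : Fin n → Fin n} (hv : v ∈ teslerPolytope a)
    (h : ∀ i j, j ≠ f i → v i j = 0) : IsPolyVertex (teslerPolytope a) v := by
  classical
  refine ⟨Set.singleton_nonempty v,
    fun _ => ⟨negEntrySum (Finset.univ.filter fun p => v p.1 p.2 = 0), ?_⟩⟩
  have hv0 : negEntrySum (Finset.univ.filter fun p => v p.1 p.2 = 0) v = 0 := by
    rw [negEntrySum_apply, Finset.sum_eq_zero (by simp), neg_zero]
  ext x
  constructor
  · rintro rfl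
    refine ⟨hv, fun y hy => ?_⟩
    rw [hv0, negEntrySum_apply, neg_nonpos]
    exact Finset.sum_nonneg fun p _ => hy.2.1 _ _
  · rintro ⟨hx, hmax⟩
    have h1 := hmax v hv
    rw [hv0, negEntrySum_apply, neg_nonneg] at h1
    have h2 := (Finset.sum_eq_zero_iff_of_nonneg fun p _ => hx.2.1 p.1 p.2).1
      (le_antisymm h1 (Finset.sum_nonneg fun p _ => hx.2.1 _ _))
    have h3 := eq_zero_of_mem_teslerDirection (f := f) (sub_mem_teslerDirection hx hv)
      fun i j _ hj => by
        rw [Matrix.sub_apply, h i j hj, sub_zero]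
        exact h2 (i, j) (by simp [h i j hj])
    exact sub_eq_zero.1 h3

/-- Every row of a vertex has at most one nonzero entry. -/
theorem IsPolyVertex.exists_row_support (h : IsPolyVertex (teslerPolytope a) v) :
    ∃ f : Fin n → Fin n, (∀ i, i ≤ f i) ∧ (∀ i j, j ≠ f i → v i j = 0) ∧
      ∀ i, v i (f i) = 0 → f i = i := by
  classical
  obtain ⟨l, hl⟩ := h.2 (Set.singleton_nonempty v)
  have hvmem : v ∈ {x ∈ teslerPolytope a | ∀ y ∈ teslerPolytope a, l y ≤ l x} :=
    hl ▸ Set.mem_singleton v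
  have hv := hvmem.1
  -- The default `i` on a zero row makes the last conclusion hold.
  let f : Fin n → Fin n := fun i => if h : ∃ j, v i j ≠ 0 then h.choose else i
  have hf1 : ∀ i, v i (f i) = 0 → (∀ j, v i j = 0) ∧ f i = i := by
    intro i hi
    by_cases h : ∃ j, v i j ≠ 0
    · have hfi : f i = h.choose := dif_pos h
      exact absurd (hfi ▸ hi) h.choose_spec
    · exact ⟨by simpa using h, dif_neg h⟩
  have hf : ∀ i, i ≤ f i := by
    intro i
    by_cases hi : v i (f i) = 0
    · exact (hf1 i hi).2.ge
    · by_contra hlt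
      exact hi (hv.1 i _ (not_le.1 hlt))
  refine ⟨f, hf, fun i₀ j₀ hj₀ => ?_, fun i hi => (hf1 i hi).2⟩
  by_contra hne
  have hij₀ : i₀ ≤ j₀ := by
    by_contra hlt
    exact hne (hv.1 _ _ (not_le.1 hlt))
  -- A second nonzero entry at `(i₀, j₀)` can be perturbed, the change being absorbed along `f`. The
  -- support stays inside that of `v`, so both `v + ε • y` and `v - δ • y` remain in the polytope.
  obtain ⟨y, hy, hyz⟩ := exists_mem_teslerDirection hf (Matrix.single i₀ j₀ 1)
  have hsupp : ∀ i j, v i j = 0 → y i j = 0 := by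
    intro i
    induction i using WellFoundedLT.induction with
    | ind i ih =>
      have hoff : ∀ j, j ≠ f i → v i j = 0 → y i j = 0 := fun j hj hvj => by
        rcases lt_or_ge j i with hji | hij
        · exact hy.1 i j hji
        · rw [hyz i j hij hj, Matrix.single_apply, if_neg]
          rintro ⟨rfl, rfl⟩
          exact hne hvj
      intro j hvj
      by_cases hj : j = f i
      · have hrow := (hf1 i (hj ▸ hvj)).1
        have h3 := (col_eq_zero_of_row_eq_zero hv hrow).2
        have h4 := row_eq_col hy i
        rw [Finset.sum_eq_single (f i) (fun j _ hj => hoff j hj (hrow j)) (by simp),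
          Finset.sum_eq_zero fun m hm => ih m (Finset.mem_Iio.1 hm) i
            (h3 m (Finset.mem_Iio.1 hm))] at h4
        rw [hj, h4]
      · exact hoff j hj hvj
  have hstep : ∀ w ∈ teslerDirection n, (∀ i j, v i j = 0 → w i j = 0) →
      ∃ ε : ℝ, 0 < ε ∧ v + ε • w ∈ teslerPolytope a := by
    intro w hw hws
    obtain ⟨ε, hε, h⟩ := exists_pos_add_smul_nonneg hv.2.1 fun i j hij => (hws i j hij).ge
    exact ⟨ε, hε, add_mem_teslerPolytope hv (Submodule.smul_mem _ ε hw) h⟩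
  obtain ⟨ε, hε, hP⟩ := hstep y hy hsupp
  obtain ⟨δ, hδ, hQ⟩ := hstep (-y) (Submodule.neg_mem _ hy) fun i j hij => by
    rw [Matrix.neg_apply, hsupp i j hij, neg_zero]
  have hly : 0 ≤ l y := by
    have := hvmem.2 _ hQ
    rw [map_add, map_smul, map_neg, smul_eq_mul] at this
    nlinarith
  have hmem : v + ε • y ∈ ({v} : Set (Matrix (Fin n) (Fin n) ℝ)) := by
    rw [hl]
    refine ⟨hP, fun z hz => (hvmem.2 z hz).trans ?_⟩
    rw [map_add, map_smul, smul_eq_mul]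
    nlinarith
  have h0 : ε • y = 0 := by simpa using hmem
  have hy0 : y = 0 := (smul_eq_zero.1 h0).resolve_left hε.ne'
  have h1 := hyz i₀ j₀ hij₀ hj₀
  simp [hy0] at h1

/-- At a point of a Tesler polytope with known extreme rays, the number of edges is the dimension
exactly when the rays are linearly independent. -/
theorem encard_edges_tesler_iff {ι : Type*} [Fintype ι] {u : ι → Matrix (Fin n) (Fin n) ℝ}
    (hv : v ∈ teslerPolytope a) (hu : ∀ e, u e ∈ teslerDirection n) (hne : ∀ e, u e ≠ 0)
    (hnn : ∀ e i j, v i j = 0 → 0 ≤ u e i j)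
    (hsep : ∀ e e', e' ≠ e → ∃ i j, v i j = 0 ∧ u e i j = 0 ∧ 0 < u e' i j)
    (hgen : ∀ x ∈ teslerPolytope a, ∃ c : ι → ℝ, (∀ e, 0 ≤ c e) ∧ x = v + ∑ e, c e • u e) :
    {F | IsPolyEdge (teslerPolytope a) F ∧ v ∈ F}.encard = (polyDim (teslerPolytope a) : ℕ∞) ↔
      LinearIndependent ℝ u := by
  classical
  refine encard_edges_eq_polyDim_iff hv hgen (fun e => ?_) hne fun e => ?_
  · obtain ⟨ε, hε, h⟩ := exists_pos_add_smul_nonneg hv.2.1 (hnn e)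
    exact ⟨ε, hε, add_mem_teslerPolytope hv (Submodule.smul_mem _ ε (hu e)) h⟩
  -- The functional sums the constraints active both at `v` and along `u e`; by `hsep` each other
  -- ray leaves at least one of them.
  · refine ⟨negEntrySum (Finset.univ.filter fun p => v p.1 p.2 = 0 ∧ u e p.1 p.2 = 0), ?_, ?_⟩
    · rw [negEntrySum_apply, Finset.sum_eq_zero (by simp), neg_zero]
    · intro e' he'
      obtain ⟨i, j, h1, h2, h3⟩ := hsep e e' he'
      rw [negEntrySum_apply, neg_lt_zero]
      refine Finset.sum_pos' (fun p hp => hnn e' _ _ (Finset.mem_filter.1 hp).2.1)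
        ⟨(i, j), by simp [h1, h2], h3⟩

end TeslerVertices

/-! ### Vertices with no zero row before the last -/

section RegularVertices

variable {n : ℕ} {a : Fin n → ℕ} {v : Matrix (Fin n) (Fin n) ℝ}

/-- Nonnegativity of a direction on the zero entries of `v` need not be checked in the last
row. -/
theorem nonneg_of_nonneg_above_last {y : Matrix (Fin n) (Fin n) ℝ} (hv : v ∈ teslerPolytope a)
    (hy : y ∈ teslerDirection n)
    (h : ∀ i j : Fin n, i ≤ j → i.val + 1 < n → v i j = 0 → 0 ≤ y i j) (i j : Fin n)
    (hij : v i j = 0) : 0 ≤ y i j := by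
  rcases lt_or_ge j i with hji | hle
  · exact (hy.1 i j hji).ge
  · by_cases hi : i.val + 1 < n
    · exact h i j hle hi hij
    · have hj : ∀ m, m ≠ i → m < i := fun m hm => by
        have := m.isLt
        have : m.val ≠ i.val := fun h => hm (Fin.ext h)
        exact Fin.lt_def.2 (by omega)
      -- In the last row only the diagonal entry can be nonzero, and it equals the sum of the column
      -- above it.
      obtain rfl : j = i := by
        by_contra hne
        exact (hj j hne).not_ge hle
      have hrow : ∀ m, v j m = 0 := fun m => by
        by_cases hm : m = j
        · rw [hm, hij]
        · exact hv.1 j m (hj m hm)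
      have h1 := row_eq_col hy j
      rw [Finset.sum_eq_single j (fun m _ hm => hy.1 j m (hj m hm)) (by simp)] at h1
      rw [h1]
      refine Finset.sum_nonneg fun m hm => ?_
      have hmj := Finset.mem_Iio.1 hm
      have := j.isLt
      exact h m j hmj.le (by have := Fin.lt_def.1 hmj; omega)
        ((col_eq_zero_of_row_eq_zero hv hrow).2 m hmj)

/-- A vertex all of whose rows, except possibly the last, are nonzero has the right number of
edges. -/
theorem encard_edges_of_rows_ne_zero {f : Fin n → Fin n} (hv : v ∈ teslerPolytope a)
    (hf : ∀ i, i ≤ f i) (hsupp : ∀ i j, j ≠ f i → v i j = 0)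
    (hz : ∀ i : Fin n, v i (f i) = 0 → ¬ i.val + 1 < n) :
    {F | IsPolyEdge (teslerPolytope a) F ∧ v ∈ F}.encard =
      (polyDim (teslerPolytope a) : ℕ∞) := by
  classical
  -- The ray `u e` has free coordinate 1 at `e` and 0 elsewhere, so coefficients can be read off as
  -- entries.
  choose u hu huz using fun e : {p : Fin n × Fin n // p.1 ≤ p.2 ∧ p.2 ≠ f p.1} =>
    exists_mem_teslerDirection hf (Matrix.single e.1.1 e.1.2 1)
  have hdiag : ∀ e, u e e.1.1 e.1.2 = 1 := fun e => by
    rw [huz e _ _ e.2.1 e.2.2, Matrix.single_apply_same]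
  have hoff : ∀ e e', e' ≠ e → u e e'.1.1 e'.1.2 = 0 := fun e e' hne => by
    rw [huz e _ _ e'.2.1 e'.2.2, Matrix.single_apply, if_neg]
    rintro ⟨h1, h2⟩
    exact hne (Subtype.ext (Prod.ext h1.symm h2.symm))
  have heval : ∀ (c : {p : Fin n × Fin n // p.1 ≤ p.2 ∧ p.2 ≠ f p.1} → ℝ) e,
      (∑ e', c e' • u e') e.1.1 e.1.2 = c e := fun c e => by
    rw [Matrix.sum_apply, Finset.sum_eq_single e]
    · simp [hdiag]
    · intro e' _ hne
      simp [hoff e' e hne.symm]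
    · simp
  rw [encard_edges_tesler_iff hv hu]
  · refine Fintype.linearIndependent_iff.2 fun g hg e => ?_
    rw [← heval g e, hg, Matrix.zero_apply]
  · intro e h0
    have := hdiag e
    simp [h0] at this
  · intro e
    refine nonneg_of_nonneg_above_last hv (hu e) fun i j hij hi h0 => ?_
    rw [huz e i j hij fun hj => hz i (hj ▸ h0) hi, Matrix.single_apply]
    split_ifs <;> norm_num
  · intro e e' hne
    exact ⟨e'.1.1, e'.1.2, hsupp _ _ e'.2.2, hoff e e' hne, by rw [hdiag]; norm_num⟩
  · intro x hx
    refine ⟨fun e => x e.1.1 e.1.2, fun e => hx.2.1 _ _, ?_⟩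
    rw [← sub_eq_iff_eq_add', ← sub_eq_zero]
    refine eq_zero_of_mem_teslerDirection (f := f)
      (Submodule.sub_mem _ (sub_mem_teslerDirection hx hv)
        (Submodule.sum_mem _ fun e _ => Submodule.smul_mem _ _ (hu e))) fun i j hij hj => ?_
    rw [Matrix.sub_apply, heval _ ⟨(i, j), hij, hj⟩, Matrix.sub_apply, hsupp i j hj]
    ring

end RegularVertices

/-! ### Vertices with a zero row: the cone over a product of simplices -/

section TransitVertices

variable {n : ℕ} {a : Fin n → ℕ} {v : Matrix (Fin n) (Fin n) ℝ}

/-- The extreme rays at a vertex whose row `k` is zero: entries away from row and column `k`,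
and pairs of an entry of column `k` and an entry of row `k`. -/
abbrev TransitIndex (f : Fin n → Fin n) (k : Fin n) : Type :=
  {p : Fin n × Fin n // p.1 ≤ p.2 ∧ p.2 ≠ f p.1 ∧ p.1 ≠ k ∧ p.2 ≠ k} ⊕
    ({i : Fin n // i < k} × {j : Fin n // k ≤ j})

/-- The entries of the extreme rays that can be prescribed at a vertex whose row `k` is zero. -/
noncomputable def transitEntries (f : Fin n → Fin n) (k : Fin n) :
    TransitIndex f k → Matrix (Fin n) (Fin n) ℝ :=
  Sum.elim (fun p => Matrix.single p.1.1 p.1.2 1)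
    (fun q => Matrix.single q.1.1 k 1 + Matrix.single k q.2.1 1)

variable {f : Fin n → Fin n} {k : Fin n}

theorem transitEntries_nonneg (e : TransitIndex f k) (i j : Fin n) :
    0 ≤ transitEntries f k e i j := by
  rcases e with p | q
  · simp only [transitEntries, Sum.elim_inl, Matrix.single_apply]
    split_ifs <;> norm_num
  · simp only [transitEntries, Sum.elim_inr, Matrix.add_apply, Matrix.single_apply]
    split_ifs <;> norm_num

theorem sum_transitEntries_of_ne (c : TransitIndex f k → ℝ) {i j : Fin n} (hij : i ≤ j)
    (hj : j ≠ f i) (hik : i ≠ k) (hjk : j ≠ k) :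
    ∑ e, c e * transitEntries f k e i j = c (Sum.inl ⟨(i, j), hij, hj, hik, hjk⟩) := by
  rw [Fintype.sum_sum_type, Finset.sum_eq_single ⟨(i, j), hij, hj, hik, hjk⟩,
    Finset.sum_eq_zero]
  · simp [transitEntries]
  · intro q _
    simp [transitEntries, hik.symm, hjk.symm]
  · intro p _ hp
    have : ¬ (p.1.1 = i ∧ p.1.2 = j) := fun h => hp (Subtype.ext (Prod.ext h.1 h.2))
    simp [transitEntries, this]
  · simp

theorem sum_transitEntries_col (c : TransitIndex f k → ℝ) {i : Fin n} (hik : i < k) :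
    ∑ e, c e * transitEntries f k e i k = ∑ j, c (Sum.inr (⟨i, hik⟩, j)) := by
  rw [Fintype.sum_sum_type, Finset.sum_eq_zero, zero_add, Fintype.sum_prod_type,
    Finset.sum_eq_single ⟨i, hik⟩]
  · refine Finset.sum_congr rfl fun j _ => ?_
    simp [transitEntries, hik.ne']
  · intro i' _ hi'
    have : i'.1 ≠ i := fun h => hi' (Subtype.ext h)
    refine Finset.sum_eq_zero fun j _ => ?_
    simp [transitEntries, hik.ne', this]
  · simp
  · intro p _
    simp [transitEntries, p.2.2.2.2]

theorem sum_transitEntries_row (c : TransitIndex f k → ℝ) {j : Fin n} (hkj : k ≤ j) :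
    ∑ e, c e * transitEntries f k e k j = ∑ i, c (Sum.inr (i, ⟨j, hkj⟩)) := by
  rw [Fintype.sum_sum_type, Finset.sum_eq_zero, zero_add, Fintype.sum_prod_type]
  · refine Finset.sum_congr rfl fun i _ => ?_
    rw [Finset.sum_eq_single ⟨j, hkj⟩]
    · simp [transitEntries, i.2.ne]
    · intro j' _ hj'
      have : j'.1 ≠ j := fun h => hj' (Subtype.ext h)
      simp [transitEntries, i.2.ne, this]
    · simp
  · intro p _
    simp [transitEntries, p.2.2.2.1]

theorem transitEntries_row_eq_col (e : TransitIndex f k) :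
    ∑ j, transitEntries f k e k j = ∑ i ∈ Finset.Iio k, transitEntries f k e i k := by
  rcases e with p | q
  · simp [transitEntries, p.2.2.2.1, p.2.2.2.2]
  · have h : ∀ i ∈ Finset.Iio k,
        transitEntries f k (Sum.inr q) i k = if q.1.1 = i then 1 else 0 := by
      intro i hi
      simp [transitEntries, Matrix.single_apply, (Finset.mem_Iio.1 hi).ne']
    rw [Finset.sum_congr rfl h]
    simp [transitEntries, Matrix.single_apply, q.1.2.ne, q.1.2]

theorem transitEntries_row_of_lt (e : TransitIndex f k) {j : Fin n} (hj : j < k) :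
    transitEntries f k e k j = 0 := by
  rcases e with p | q
  · simp [transitEntries, p.2.2.2.1]
  · simp [transitEntries, q.1.2.ne, (hj.trans_le q.2.2).ne']

/-- The extreme rays at a vertex whose row `k` is zero. -/
theorem exists_transit_rays (hf : ∀ i, i ≤ f i) (hk : f k = k) (hfk : ∀ i < k, f i ≠ k) :
    ∃ u : TransitIndex f k → Matrix (Fin n) (Fin n) ℝ, (∀ e, u e ∈ teslerDirection n) ∧
      ∀ e i j, i ≤ j → (j ≠ f i ∨ i = k) → u e i j = transitEntries f k e i j := by
  choose u hu huz using fun e : TransitIndex f k =>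
    exists_mem_teslerDirection hf (transitEntries f k e)
  refine ⟨u, hu, fun e i j hij h => ?_⟩
  by_cases hj : j = f i
  -- The diagonal entry of row `k` is not a free coordinate, since `f k = k`; equality of row and
  -- column sums recovers it.
  · obtain rfl := h.resolve_left (not_not_intro hj)
    have hrow : ∑ m, u e i m = ∑ m, transitEntries f i e i m := by
      rw [row_eq_col (hu e), transitEntries_row_eq_col]
      exact Finset.sum_congr rfl fun m hm =>
        huz e m i (Finset.mem_Iio.1 hm).le (hfk m (Finset.mem_Iio.1 hm)).symm
    rw [← Finset.add_sum_erase _ _ (Finset.mem_univ i),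
      ← Finset.add_sum_erase _ (transitEntries f i e i) (Finset.mem_univ i),
      Finset.sum_congr rfl fun m hm => ?_] at hrow
    · rw [hj, hk]
      exact add_right_cancel hrow
    · have hmi := Finset.ne_of_mem_erase hm
      rcases lt_or_gt_of_ne hmi with hlt | hgt
      · rw [(hu e).1 i m hlt, transitEntries_row_of_lt e hlt]
      · exact huz e i m hgt.le (by rwa [hk])
  · exact huz e i j hij hj

/-- The entries that a direction of the polytope must have in order to be generated by the
extreme rays. -/
theorem exists_transit_coeff (hv : v ∈ teslerPolytope a) (hvk : ∀ j, v k j = 0)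
    {x : Matrix (Fin n) (Fin n) ℝ} (hx : x ∈ teslerPolytope a) :
    ∃ c : TransitIndex f k → ℝ, (∀ e, 0 ≤ c e) ∧ ∀ i j, i ≤ j → j ≠ f i →
      ∑ e, c e * transitEntries f k e i j = x i j := by
  -- `R` is the flow through `k`, computed from row `k` or, since `a k = 0`, from column `k`.
  set R := ∑ j : {j : Fin n // k ≤ j}, x k j with hR
  have hRcol : R = ∑ i : {i : Fin n // i < k}, x i k := by
    have h := row_eq_add_col hx k
    rw [(col_eq_zero_of_row_eq_zero hv hvk).1, Nat.cast_zero, zero_add,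
      Finset.sum_subtype (p := (· < k)) _ (fun i => Finset.mem_Iio) fun i => x i k] at h
    rw [← h, hR, ← Finset.sum_subtype (Finset.Ici k) (fun j => Finset.mem_Ici) fun j => x k j]
    exact Finset.sum_subset (Finset.subset_univ _) fun j _ hj =>
      hx.1 k j (not_le.1 fun h => hj (Finset.mem_Ici.2 h))
  have hR0 : 0 ≤ R := Finset.sum_nonneg fun j _ => hx.2.1 _ _
  -- The product coupling of column `k` and row `k` has the right marginals. If `R = 0`, both vanish
  -- and division by zero returns 0, as needed.
  refine ⟨Sum.elim (fun p => x p.1.1 p.1.2) (fun q => x q.1 k * x k q.2 / R), ?_, ?_⟩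
  · rintro (p | q)
    · exact hx.2.1 _ _
    · exact div_nonneg (mul_nonneg (hx.2.1 _ _) (hx.2.1 _ _)) hR0
  · intro i j hij hj
    by_cases hik : i = k
    · subst hik
      rw [sum_transitEntries_row _ hij]
      simp only [Sum.elim_inr]
      rw [← Finset.sum_div, ← Finset.sum_mul, ← hRcol, mul_comm]
      refine mul_div_cancel_of_imp fun h0 => ?_
      exact (Finset.sum_eq_zero_iff_of_nonneg fun j _ => hx.2.1 _ _).1 (hR.symm.trans h0)
        ⟨j, hij⟩ (Finset.mem_univ _)
    by_cases hjk : j = k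
    · subst hjk
      have hlt := lt_of_le_of_ne hij hik
      rw [sum_transitEntries_col _ hlt]
      simp only [Sum.elim_inr]
      rw [← Finset.sum_div, ← Finset.mul_sum]
      refine mul_div_cancel_of_imp fun h0 => ?_
      exact (Finset.sum_eq_zero_iff_of_nonneg fun i _ => hx.2.1 _ _).1 (hRcol.symm.trans h0)
        ⟨i, hlt⟩ (Finset.mem_univ _)
    · rw [sum_transitEntries_of_ne _ hij hj hik hjk]
      rfl

theorem transitEntries_separate (hfk : ∀ i < k, f i ≠ k) {e e' : TransitIndex f k}
    (hne : e' ≠ e) : ∃ i j, i ≤ j ∧ (j ≠ f i ∨ i = k) ∧ transitEntries f k e i j = 0 ∧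
      0 < transitEntries f k e' i j := by
  rcases e' with p' | q'
  · refine ⟨p'.1.1, p'.1.2, p'.2.1, Or.inl p'.2.2.1, ?_, by simp [transitEntries]⟩
    rcases e with p | q
    · have : ¬ (p.1.1 = p'.1.1 ∧ p.1.2 = p'.1.2) := fun h =>
        hne (congrArg Sum.inl (Subtype.ext (Prod.ext h.1.symm h.2.symm)))
      simp [transitEntries, this]
    · simp [transitEntries, Ne.symm p'.2.2.2.1, Ne.symm p'.2.2.2.2]
  · rcases e with p | q
    · exact ⟨q'.1.1, k, q'.1.2.le, Or.inl (hfk _ q'.1.2).symm,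
        by simp [transitEntries, p.2.2.2.2], by simp [transitEntries, q'.1.2.ne']⟩
    · by_cases h1 : q.1 = q'.1
      · have h2 : q.2.1 ≠ q'.2.1 := fun h2 =>
          hne (congrArg Sum.inr (Prod.ext h1.symm (Subtype.ext h2.symm)))
        exact ⟨k, q'.2.1, q'.2.2, Or.inr rfl, by simp [transitEntries, q.1.2.ne, h2],
          by simp [transitEntries, q'.1.2.ne]⟩
      · have h2 : q.1.1 ≠ q'.1.1 := fun h2 => h1 (Subtype.ext h2)
        exact ⟨q'.1.1, k, q'.1.2.le, Or.inl (hfk _ q'.1.2).symm,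
          by simp [transitEntries, q'.1.2.ne', h2], by simp [transitEntries, q'.1.2.ne']⟩

/-- A vertex whose row `k` is zero, where `k` is not the last index, and whose other rows, except
possibly the last, are nonzero, has the right number of edges exactly when `k` is the second
index. -/
theorem encard_edges_of_transit_iff (hv : v ∈ teslerPolytope a) (hf : ∀ i, i ≤ f i)
    (hsupp : ∀ i j, j ≠ f i → v i j = 0) (hk : f k = k) (hkv : v k k = 0) (hk0 : 0 < k.val)
    (hkn : k.val + 1 < n) (hz : ∀ i : Fin n, v i (f i) = 0 → i.val + 1 < n → i = k) :
    {F | IsPolyEdge (teslerPolytope a) F ∧ v ∈ F}.encard =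
      (polyDim (teslerPolytope a) : ℕ∞) ↔ k.val = 1 := by
  classical
  have hvk : ∀ j, v k j = 0 := fun j => by
    by_cases hj : j = k
    · rw [hj, hkv]
    · exact hsupp k j (hk.symm ▸ hj)
  -- Column `k` vanishes above the diagonal, so an earlier row pointing to `k` would itself be zero,
  -- against `hz`.
  have hfk : ∀ i < k, f i ≠ k := fun i hi h => by
    have h1 := (col_eq_zero_of_row_eq_zero hv hvk).2 i hi
    have h2 := Fin.lt_def.1 hi
    exact hi.ne (hz i (h ▸ h1) (by omega))
  obtain ⟨u, hu, huz⟩ := exists_transit_rays hf hk hfk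
  have hvoff : ∀ i j, (j ≠ f i ∨ i = k) → v i j = 0 := by
    rintro i j (h | rfl)
    · exact hsupp i j h
    · exact hvk j
  have heval : ∀ (c : TransitIndex f k → ℝ) i j, i ≤ j → (j ≠ f i ∨ i = k) →
      (∑ e, c e • u e) i j = ∑ e, c e * transitEntries f k e i j := by
    intro c i j hij h
    rw [Matrix.sum_apply]
    exact Finset.sum_congr rfl fun e _ => by rw [Matrix.smul_apply, huz e i j hij h, smul_eq_mul]
  rw [encard_edges_tesler_iff hv hu]
  · constructor
    · intro hli
      by_contra hk1
      have h2 : 2 ≤ k.val := by omega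
      let i₀ : {i : Fin n // i < k} := ⟨⟨0, by omega⟩, Fin.lt_def.2 (by simpa using hk0)⟩
      let i₁ : {i : Fin n // i < k} := ⟨⟨1, by omega⟩, Fin.lt_def.2 h2⟩
      let j₀ : {j : Fin n // k ≤ j} := ⟨k, le_rfl⟩
      let j₁ : {j : Fin n // k ≤ j} := ⟨⟨k.val + 1, hkn⟩, Fin.le_def.2 (by simp)⟩
      have hi : i₀ ≠ i₁ := fun h => by simpa [i₀, i₁] using congrArg (fun i => i.1.val) h
      have hj : j₀ ≠ j₁ := fun h => by simpa [j₀, j₁] using congrArg (fun j => j.1.val) h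
      -- The two pairings of two sources with two targets carry the same flow in every free
      -- coordinate.
      have hrel : u (Sum.inr (i₀, j₀)) + u (Sum.inr (i₁, j₁)) -
          (u (Sum.inr (i₀, j₁)) + u (Sum.inr (i₁, j₀))) = 0 := by
        refine eq_zero_of_mem_teslerDirection (f := f)
          (Submodule.sub_mem _ (Submodule.add_mem _ (hu _) (hu _))
            (Submodule.add_mem _ (hu _) (hu _))) fun i j hij hj => ?_
        simp only [Matrix.sub_apply, Matrix.add_apply, huz _ i j hij (Or.inl hj), transitEntries,
          Sum.elim_inr]
        ring
      have h3 : Finsupp.single (Sum.inr (i₀, j₀) : TransitIndex f k) (1 : ℝ) +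
          Finsupp.single (Sum.inr (i₁, j₁)) 1 =
          Finsupp.single (Sum.inr (i₀, j₁)) 1 + Finsupp.single (Sum.inr (i₁, j₀)) 1 := by
        apply hli
        simpa [sub_eq_zero] using hrel
      have h4 := DFunLike.congr_fun h3 (Sum.inr (i₀, j₀))
      simp [hi.symm, hj.symm] at h4
    · intro hk1
      refine Fintype.linearIndependent_iff.2 fun g hg => ?_
      have hg' : ∀ i j, i ≤ j → (j ≠ f i ∨ i = k) →
          ∑ e, g e * transitEntries f k e i j = 0 := fun i j hij h => by
        rw [← heval g i j hij h, hg, Matrix.zero_apply]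
      rintro (⟨p, hp⟩ | ⟨i, j⟩)
      · rw [← sum_transitEntries_of_ne g hp.1 hp.2.1 hp.2.2.1 hp.2.2.2]
        exact hg' _ _ hp.1 (Or.inl hp.2.1)
      -- With `k = 1` there is a single source, so each entry of row `k` isolates one coefficient.
      · have h1 := hg' k j.1 j.2 (Or.inr rfl)
        rw [sum_transitEntries_row g j.2, Finset.sum_eq_single i] at h1
        · exact h1
        · intro i' _ hi'
          have h2 := Fin.lt_def.1 i.2
          have h3 := Fin.lt_def.1 i'.2
          exact absurd (Subtype.ext (Fin.ext (by omega))) hi'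
        · simp
  · rintro (p | q) h0
    · have := huz (Sum.inl p) p.1.1 p.1.2 p.2.1 (Or.inl p.2.2.1)
      simp [h0, transitEntries] at this
    · have := huz (Sum.inr q) k q.2.1 q.2.2 (Or.inr rfl)
      simp [h0, transitEntries, q.1.2.ne] at this
  · intro e
    refine nonneg_of_nonneg_above_last hv (hu e) fun i j hij hi h0 => ?_
    rw [huz e i j hij]
    · exact transitEntries_nonneg e i j
    · by_cases hj : j = f i
      · exact Or.inr (hz i (hj ▸ h0) hi)
      · exact Or.inl hj
  · intro e e' hne
    obtain ⟨i, j, hij, h, h1, h2⟩ := transitEntries_separate hfk hne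
    exact ⟨i, j, hvoff i j h, by rw [huz e i j hij h, h1], by rwa [huz e' i j hij h]⟩
  · intro x hx
    obtain ⟨c, hc, hcx⟩ := exists_transit_coeff hv hvk hx
    refine ⟨c, hc, ?_⟩
    rw [← sub_eq_iff_eq_add', ← sub_eq_zero]
    refine eq_zero_of_mem_teslerDirection (f := f)
      (Submodule.sub_mem _ (sub_mem_teslerDirection hx hv)
        (Submodule.sum_mem _ fun e _ => Submodule.smul_mem _ _ (hu e))) fun i j hij hj => ?_
    rw [Matrix.sub_apply, heval c i j hij (Or.inl hj), hcx i j hij hj, Matrix.sub_apply,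
      hsupp i j hj]
    ring

end TransitVertices

/-! ### Translation between zero positions and words -/

section Signature

variable {n : ℕ}

/-- The simple Tesler polytopes, described by the positions of the zeros. -/
theorem signature_words_iff (hn : 0 < n) (a : Fin n → ℕ) (ha : 0 < a ⟨0, hn⟩) :
    (n ≤ 3 ∨
      signature a = List.replicate n SigLetter.plus ∨
      signature a = List.replicate (n - 1) SigLetter.plus ++ [SigLetter.zero] ∨
      signature a = [SigLetter.plus, SigLetter.zero] ++ List.replicate (n - 2) SigLetter.plus ∨
      signature a = [SigLetter.plus, SigLetter.zero] ++ List.replicate (n - 3) SigLetter.plus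
        ++ [SigLetter.zero]) ↔
      ∀ i : Fin n, a i = 0 → i.val + 1 < n → i.val = 1 := by
  have hlen : (signature a).length = n := by simp [signature]
  have hget : ∀ (i : ℕ) (hi : i < n), (signature a)[i]'(hlen.symm ▸ hi) =
      if a ⟨i, hi⟩ = 0 then SigLetter.zero else SigLetter.plus := fun i hi => by
    simp [signature]
  have hne : ∀ i : Fin n, a i = 0 → i.val ≠ 0 := fun i h0 hi => by
    have : i = ⟨0, hn⟩ := Fin.ext hi
    rw [this] at h0
    omega
  have hplus : ∀ i : Fin n, a i = 0 → ∀ (L : List SigLetter) (h : signature a = L)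
      (hL : i.val < L.length), L[i.val] = SigLetter.zero := fun i h0 L h hL => by
    subst h
    rw [hget i i.isLt, if_pos h0]
  constructor
  · rintro (h | h | h | h | h) i h0 hi
    · have := hne i h0
      omega
    all_goals
      have h1 := hplus i h0 _ h (by rw [← h, hlen]; exact i.isLt)
      have h2 := hne i h0
      by_contra h3
    · simp at h1
    · rw [List.getElem_append_left (by simp; omega)] at h1
      simp at h1
    · rw [List.getElem_append_right (by simp; omega)] at h1
      simp at h1
    · rw [List.getElem_append_left (by simp; omega),
        List.getElem_append_right (by simp; omega)] at h1
      simp at h1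
  · intro h
    -- Beyond this case the truncated subtractions are exact, and indices 1 and `n - 1` are
    -- distinct.
    by_cases hn3 : n ≤ 3
    · exact Or.inl hn3
    right
    have hpos : ∀ (i : ℕ) (hi : i + 1 < n), i ≠ 1 → a ⟨i, by omega⟩ ≠ 0 :=
      fun i hi hi1 h0 => hi1 (h ⟨i, by omega⟩ h0 hi)
    have hext : ∀ L : List SigLetter, L.length = n → (∀ (i : ℕ) (hi : i < n) (hL : i < L.length),
        (if a ⟨i, hi⟩ = 0 then SigLetter.zero else SigLetter.plus) = L[i]) → signature a = L :=
      fun L hL hLi => List.ext_getElem (hlen.trans hL.symm) fun i _ h2 => by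
        rw [hget i (hL ▸ h2), hLi i (hL ▸ h2) h2]
    by_cases h1 : a ⟨1, by omega⟩ = 0 <;> by_cases h2 : a ⟨n - 1, by omega⟩ = 0
    on_goal 1 => right; right; right
    on_goal 2 => right; right; left
    on_goal 3 => right; left
    on_goal 4 => left
    all_goals
      refine hext _ (by simp; try omega) fun i hi hL => ?_
      have hi1 : i = 1 → (a ⟨i, hi⟩ = 0 ↔ a ⟨1, by omega⟩ = 0) := by rintro rfl; rfl
      have hin : i = n - 1 → (a ⟨i, hi⟩ = 0 ↔ a ⟨n - 1, by omega⟩ = 0) := by rintro rfl; rfl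
      have hmid : i + 1 < n → i ≠ 1 → a ⟨i, hi⟩ ≠ 0 := hpos i
      simp only [List.cons_append, List.nil_append, List.getElem_cons, List.getElem_append,
        List.getElem_replicate, List.length_replicate]
      split_ifs <;> first | rfl | omega

end Signature

/-! ### Realising zero rows and concluding -/

section Main

variable {n : ℕ} {a : Fin n → ℕ}

/-- The vertex of a Tesler polytope that sends everything along the path avoiding `k`. -/
theorem exists_vertex_avoiding (hn : 0 < n) (ha : 0 < a ⟨0, hn⟩) {k : Fin n} (hk0 : 0 < k.val)
    (hkn : k.val + 1 < n) (hak : a k = 0) :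
    ∃ (v : Matrix (Fin n) (Fin n) ℝ) (f : Fin n → Fin n), v ∈ teslerPolytope a ∧
      (∀ i, i ≤ f i) ∧ (∀ i j, j ≠ f i → v i j = 0) ∧ f k = k ∧ v k k = 0 ∧
      ∀ i, v i (f i) = 0 → i = k := by
  -- The path `0 → 1 → ⋯ → k - 1 → k + 1 → ⋯ → n - 1`, with `k` and the last index fixed.
  let f : Fin n → Fin n := fun i =>
    if i = k then k else if h : i.val + 1 = k.val then ⟨k.val + 1, hkn⟩
    else if h : i.val + 1 < n then ⟨i.val + 1, h⟩ else i
  have hfk : f k = k := if_pos rfl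
  have hf : ∀ i, i ≤ f i := by
    intro i
    simp only [f]
    split_ifs with h1 h2 h3
    · exact h1.le
    · exact Fin.le_def.2 (by simp; omega)
    · exact Fin.le_def.2 (by simp)
    · exact le_rfl
  have hfne : ∀ i, i ≠ k → f i ≠ k := by
    intro i hi
    simp only [f, if_neg hi]
    split_ifs with h2 h3
    · exact fun h => by simpa using congrArg Fin.val h
    · exact fun h => h2 (congrArg Fin.val h)
    · exact hi
  have hfpred : ∀ i : Fin n, i ≠ k → i.val ≠ 0 → ∃ m, m < i ∧ m ≠ k ∧ f m = i := by
    intro i hik hi0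
    have hik' : i.val ≠ k.val := fun h => hik (Fin.ext h)
    have hi := i.isLt
    by_cases h : i.val = k.val + 1
    · have hm : (⟨k.val - 1, by omega⟩ : Fin n) ≠ k := fun h => by
        have := congrArg Fin.val h
        simp at this
        omega
      refine ⟨⟨k.val - 1, by omega⟩, Fin.lt_def.2 (by simp; omega), hm, ?_⟩
      simp only [f, if_neg hm]
      rw [dif_pos (by omega)]
      exact Fin.ext h.symm
    · have hm : (⟨i.val - 1, by omega⟩ : Fin n) ≠ k := fun h => by
        have := congrArg Fin.val h
        simp at this
        omega
      refine ⟨⟨i.val - 1, by omega⟩, Fin.lt_def.2 (by simp; omega), hm, ?_⟩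
      simp only [f, if_neg hm]
      rw [dif_neg (by omega), dif_pos (by omega)]
      exact Fin.ext (by simp; omega)
  obtain ⟨v, hv1, hv2, hv3⟩ := exists_hookSum_eq hf 0 fun i => (a i : ℝ)
  have hsupp : ∀ i j, j ≠ f i → v i j = 0 := fun i j hj => by
    rcases lt_or_ge j i with hji | hij
    · exact hv1 i j hji
    · exact hv3 i j hij hj
  have hrec : ∀ i, v i (f i) = a i + ∑ m ∈ Finset.Iio i, v m i := fun i => by
    have h := hv2 i
    rw [hookSum_eq_row_sub_col hv1, Finset.sum_eq_single (f i) (fun j _ hj => hsupp i j hj)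
      (by simp)] at h
    linarith
  have hnn : ∀ i j, 0 ≤ v i j := by
    intro i
    induction i using WellFoundedLT.induction with
    | ind i ih =>
      intro j
      by_cases hj : j = f i
      · rw [hj, hrec]
        exact add_nonneg (Nat.cast_nonneg _)
          (Finset.sum_nonneg fun m hm => ih m (Finset.mem_Iio.1 hm) i)
      · exact (hsupp i j hj).ge
  -- The positive injection at index 0 travels down the path, keeping every row except `k` nonzero.
  have hpos : ∀ i, i ≠ k → 0 < v i (f i) := by
    intro i
    induction i using WellFoundedLT.induction with
    | ind i ih =>
      intro hik
      rw [hrec]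
      by_cases hi0 : i.val = 0
      · obtain rfl : i = ⟨0, hn⟩ := Fin.ext hi0
        exact add_pos_of_pos_of_nonneg (Nat.cast_pos.2 ha)
          (Finset.sum_nonneg fun m _ => hnn m _)
      · obtain ⟨m, hmi, hmk, hfm⟩ := hfpred i hik hi0
        refine add_pos_of_nonneg_of_pos (Nat.cast_nonneg _)
          (Finset.sum_pos' (fun m _ => hnn m _) ⟨m, Finset.mem_Iio.2 hmi, ?_⟩)
        have := ih m hmi hmk
        rwa [hfm] at this
  refine ⟨v, f, ⟨hv1, hnn, hv2⟩, hf, hsupp, hfk, ?_, fun i hi => ?_⟩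
  · have h := hrec k
    rwa [hfk, hak, Nat.cast_zero, zero_add, Finset.sum_eq_zero fun m hm =>
      hsupp m k (hfne m (Finset.mem_Iio.1 hm).ne).symm] at h
  · by_contra hik
    exact (hpos i hik).ne' hi

theorem isSimplePolytope_tesler_iff (hn : 0 < n) (ha : 0 < a ⟨0, hn⟩) :
    IsSimplePolytope (teslerPolytope a) ↔ ∀ i : Fin n, a i = 0 → i.val + 1 < n → i.val = 1 := by
  have hne : ∀ i : Fin n, a i = 0 → 0 < i.val := fun i h0 => by
    by_contra hi
    have : i = ⟨0, hn⟩ := Fin.ext (by simpa using hi)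
    rw [this] at h0
    omega
  constructor
  · intro h k hak hkn
    obtain ⟨v, f, hv, hf, hsupp, hfk, hvk, hz⟩ :=
      exists_vertex_avoiding hn ha (hne k hak) hkn hak
    exact (encard_edges_of_transit_iff hv hf hsupp hfk hvk (hne k hak) hkn
      fun i hi _ => hz i hi).1 (h v (isPolyVertex_of_row_support hv hsupp))
  · intro h v hvert
    have hv : v ∈ teslerPolytope a := by
      obtain ⟨l, hl⟩ := hvert.2 (Set.singleton_nonempty v)
      exact (hl ▸ Set.mem_singleton v : v ∈ {x ∈ teslerPolytope a | ∀ y ∈ teslerPolytope a,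
        l y ≤ l x}).1
    obtain ⟨f, hf, hsupp, hf0⟩ := hvert.exists_row_support
    have hrow : ∀ i, v i (f i) = 0 → a i = 0 := fun i hi =>
      (col_eq_zero_of_row_eq_zero hv fun j => by
        by_cases hj : j = f i
        · rw [hj, hi]
        · exact hsupp i j hj).1
    by_cases hz : ∃ k : Fin n, v k (f k) = 0 ∧ k.val + 1 < n
    · obtain ⟨k, hk, hkn⟩ := hz
      have hk1 := h k (hrow k hk) hkn
      refine (encard_edges_of_transit_iff hv hf hsupp (hf0 k hk) ?_ (by omega) hkn ?_).2 hk1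
      · rwa [hf0 k hk] at hk
      · intro i hi hin
        -- Any two zero rows before the last both have index 1, so they coincide.
        exact Fin.ext ((h i (hrow i hi) hin).trans hk1.symm)
    · push Not at hz
      exact encard_edges_of_rows_ne_zero hv hf hsupp fun i hi => (hz i hi).not_gt

end Main

theorem mainTheorem4 (n : ℕ) (hn : 0 < n) (a : Fin n → ℕ) (ha : 0 < a ⟨0, hn⟩) :
    IsSimplePolytope (teslerPolytope a) ↔
      n ≤ 3 ∨
      signature a = List.replicate n SigLetter.plus ∨
      signature a = List.replicate (n - 1) SigLetter.plus ++ [SigLetter.zero] ∨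
      signature a = [SigLetter.plus, SigLetter.zero] ++ List.replicate (n - 2) SigLetter.plus ∨
      signature a = [SigLetter.plus, SigLetter.zero] ++ List.replicate (n - 3) SigLetter.plus
        ++ [SigLetter.zero] := by
  rw [isSimplePolytope_tesler_iff hn ha, signature_words_iff hn a ha]
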